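/- Let $d\in\mathbb{N}$, $-\infty<a<b<+\infty$, $\xi\in\mathbb{R}^d$, $p\in[2,+\infty)$, $\varrho\in(0,1]$, and let $\|\cdot\|$ be the Euclidean norm on $\mathbb{R}^d$. Let $f:[a,b]\times\mathbb{R}^d\to\mathbb{R}^d$ satisfy: (A1) $f$ is continuous on $[a,b]\times\mathbb{R}^d$; (A2) there is $K\in[0,+\infty)$ such that $\|f(t,y)\|\le K(1+\|y\|)$ for all $t\in[a,b]$, $y\in\mathbb{R}^d$; (A3) for every $R>0$ there is $L_R\in[0,+\infty)$ such that $\|f(t,x)-f(t,y)\|\le L_R\|x-y\|$ for all $t\in[a,b]$ and all $x,y\in\mathbb{R}^d$ with $\|x\|\le R$, $\|y\|\le R$; (A4) for every $H>0$ there is $\tilde L_H\in[0,+\infty)$ such that $\|f(t,x)-f(s,x)\|\le \tilde L_H|t-s|^{\varrho}$ for all $t,s\in[a,b]$ and all $x\in\mathbb{R}^d$ with $\|x\|\le H$. Let $(\tau_j)_{j\ge 0}$ be independent random variables on a probability space $(\Omega,\Sigma,\mathbb{P})$, each uniformly distributed on $[0,1]$. For $n\in\mathbb{N}$, $n\ge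 1$, put $h=(b-a)/n$, $t_k=a+kh$, $\theta_k=t_k+h\tau_k$, and define the randomized Euler scheme by $$y_0=\xi,\qquad y_{k+1}=y_k+hf(\theta_k,y_k),\quad k=0,1,\ldots,n-1,$$ and its piecewise linear interpolation by $l_n(t)=y_k+(t-t_k)f(\theta_k,y_k)$ for $t\in[t_k,t_{k+1}]$, $k=0,1,\ldots,n-1$. Then the initial value problem $z'(t)=f(t,z(t))$, $t\in[a,b]$, $z(a)=\xi$, has a unique solution $z$ on $[a,b]$, and there exists $C\in[0,+\infty)$ such that for all $n\ge 1$ the quantity $\sup_{a\le t\le b}\|z(t)-l_n(t)\|$ is ($\mathbb{P}$-almost everywhere equal to) a random variable and $$\Bigl\|\sup_{a\le t\le b}\|z(t)-l_n(t)\|\Bigr\|_{L^p(\Omega)}\le C\,h^{\min\{\varrho+\frac12,\,1\}}.$$ -/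

import Mathlib

open MeasureTheory ProbabilityTheory Set
open scoped ENNReal

noncomputable section

namespace RandEuler

/-- `z` solves `z'(t) = f(t, z(t))` on `[a,b]`, `z(a) = ξ` (one-sided derivatives at the
end points). -/
def IsSolution {d : ℕ} (a b : ℝ) (f : ℝ → EuclideanSpace ℝ (Fin d) → EuclideanSpace ℝ (Fin d))
    (ξ : EuclideanSpace ℝ (Fin d)) (z : ℝ → EuclideanSpace ℝ (Fin d)) : Prop :=
  z a = ξ ∧ ∀ t ∈ Icc a b, HasDerivWithinAt z (f t (z t)) (Icc a b) t

/-- The step size `h = (b - a) / n`. -/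
def step (a b : ℝ) (n : ℕ) : ℝ := (b - a) / n

/-- The grid point `t_k = a + k h`. -/
def grid (a b : ℝ) (n k : ℕ) : ℝ := a + k * step a b n

/-- The random evaluation point `θ_k = t_k + h τ_k`, for a realization `τ` of the
random sequence. -/
def node (a b : ℝ) (n : ℕ) (τ : ℕ → ℝ) (k : ℕ) : ℝ := grid a b n k + step a b n * τ k

/-- The randomized Euler scheme: `y_0 = ξ`, `y_{k+1} = y_k + h f(θ_k, y_k)`. -/
def euler {d : ℕ} (a b : ℝ) (f : ℝ → EuclideanSpace ℝ (Fin d) → EuclideanSpace ℝ (Fin d))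
    (ξ : EuclideanSpace ℝ (Fin d)) (n : ℕ) (τ : ℕ → ℝ) : ℕ → EuclideanSpace ℝ (Fin d)
  | 0 => ξ
  | k + 1 => euler a b f ξ n τ k + step a b n • f (node a b n τ k) (euler a b f ξ n τ k)

/-- The linear piece `l_{k,n}(t) = y_k + (t - t_k) f(θ_k, y_k)`. -/
def piece {d : ℕ} (a b : ℝ) (f : ℝ → EuclideanSpace ℝ (Fin d) → EuclideanSpace ℝ (Fin d))
    (ξ : EuclideanSpace ℝ (Fin d)) (n : ℕ) (τ : ℕ → ℝ) (k : ℕ) (t : ℝ) :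
    EuclideanSpace ℝ (Fin d) :=
  euler a b f ξ n τ k +
    (t - grid a b n k) • f (node a b n τ k) (euler a b f ξ n τ k)

/-- The continuous piecewise linear approximation `l_n`. The index `min ⌊(t - a)/h⌋ (n - 1)`
selects, for `t ∈ [a,b]`, some `k < n` with `t ∈ [t_k, t_{k+1}]`; by `interp_eq_piece` the choice
at common end points is immaterial. -/
def interp {d : ℕ} (a b : ℝ) (f : ℝ → EuclideanSpace ℝ (Fin d) → EuclideanSpace ℝ (Fin d))
    (ξ : EuclideanSpace ℝ (Fin d)) (n : ℕ) (τ : ℕ → ℝ) (t : ℝ) : EuclideanSpace ℝ (Fin d) :=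
  piece a b f ξ n τ (min ⌊(t - a) / step a b n⌋₊ (n - 1)) t

/-- `l_n(t) = l_{k,n}(t)` for `t ∈ [t_k, t_{k+1}]`, `k = 0, …, n - 1`. -/
theorem interp_eq_piece {d : ℕ} {a b : ℝ} (hab : a < b)
    (f : ℝ → EuclideanSpace ℝ (Fin d) → EuclideanSpace ℝ (Fin d))
    (ξ : EuclideanSpace ℝ (Fin d)) {n : ℕ} (τ : ℕ → ℝ) {k : ℕ} (hk : k < n) {t : ℝ}
    (ht : t ∈ Icc (grid a b n k) (grid a b n (k + 1))) :
    interp a b f ξ n τ t = piece a b f ξ n τ k t := by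
  have hn : (0 : ℝ) < n := by exact_mod_cast (Nat.zero_le k).trans_lt hk
  have hh : 0 < step a b n := div_pos (sub_pos.2 hab) hn
  obtain ⟨h1, h2⟩ := ht
  rcases h2.lt_or_eq with h2 | h2
  · have hfl : ⌊(t - a) / step a b n⌋₊ = k := by
      have h0 : 0 ≤ (k : ℝ) * step a b n := mul_nonneg k.cast_nonneg hh.le
      unfold grid at h1 h2
      rw [Nat.floor_eq_iff (div_nonneg (by linarith) hh.le)]
      push_cast at h2
      constructor
      · rw [le_div_iff₀ hh]; linarith
      · rw [div_lt_iff₀ hh]; linarith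
    unfold interp
    rw [hfl, min_eq_left (by omega)]
  · have hfl : ⌊(t - a) / step a b n⌋₊ = k + 1 := by
      have : (t - a) / step a b n = ((k + 1 : ℕ) : ℝ) := by
        rw [h2, grid, add_sub_cancel_left, mul_div_cancel_right₀ _ hh.ne']
      rw [this, Nat.floor_natCast]
    unfold interp
    rw [hfl]
    by_cases hkn : k + 1 = n
    · rw [min_eq_right (by omega)]
      congr 1
      omega
    · rw [min_eq_left (by omega)]
      have e : t - grid a b n k = step a b n := by
        rw [h2]; unfold grid; push_cast; ring
      unfold piece
      rw [e, h2, sub_self, zero_smul, add_zero, euler]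

end RandEuler

end

/-! The linear growth condition confines every solution, and almost every Euler path, to one ball
depending only on `K`, `ξ` and `b - a`. On that ball `f` coincides with a field `g` that is bounded,
globally Lipschitz in space and globally Hölder in time (`exists_truncation`), so existence,
uniqueness and the error bound need only be proved for `g`.

For `g`, the increment of the error `z(t_k) - y_k` splits into three parts: an `O(h²)` term from
freezing `z` at `t_k`; the error of one-point random quadrature for `g(·, z(t_k))`; and `h` times a
Lipschitz difference, which discrete Gronwall absorbs. The quadrature is taken along the exact,
deterministic solution, so its errors are independent; they are centered and of size `h^(ϱ+1)`. The
maximum of their partial sums is therefore of order `√n h^(ϱ+1) ~ h^(ϱ+1/2)` in `L^p`, while the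
other contributions are `O(h)` (`norm_solution_sub_interp_le`).

The moment bound comes from Hoeffding's lemma and Doob's inequality for the exponential of the
partial sums (`exists_dominating_partial_sums`). -/

namespace RandEuler

/-! ### Maximal inequality for scalar sums -/

section MaximalInequality

variable {Ω : Type*} [MeasurableSpace Ω] {P : Measure Ω}

/-- The `L^p` norm bound of a nonnegative random variable with tail `t ↦ e^{1/2 - t}`. -/
noncomputable def momentConst (p : ℝ) : ℝ := (p * (Real.exp (1 / 2) * Real.Gamma p)) ^ (1 / p)

theorem momentConst_nonneg {p : ℝ} (hp : 0 < p) : 0 ≤ momentConst p :=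
  Real.rpow_nonneg (mul_nonneg hp.le (mul_nonneg (Real.exp_pos _).le (Real.Gamma_pos_of_pos hp).le)) _

/-- By the layer-cake formula, integrating the tail against `p t^(p-1)` produces the Gamma integral.
-/
theorem eLpNorm_le_momentConst {U : Ω → ℝ} (hU : Measurable U) (hU0 : ∀ ω, 0 ≤ U ω)
    {p : ℝ} (hp : 0 < p)
    (htail : ∀ t : ℝ, 0 < t → P {ω | t ≤ U ω} ≤ ENNReal.ofReal (Real.exp (1 / 2) * Real.exp (-t))) :
    eLpNorm U (ENNReal.ofReal p) P ≤ ENNReal.ofReal (momentConst p) := by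
  have hG := Real.GammaIntegral_convergent hp
  have hGam := (Real.Gamma_pos_of_pos hp).le
  rw [eLpNorm_eq_lintegral_rpow_enorm_toReal (by simpa using hp) ENNReal.ofReal_ne_top,
    ENNReal.toReal_ofReal hp.le]
  have h1 : ∫⁻ ω, ‖U ω‖ₑ ^ p ∂P = ∫⁻ ω, ENNReal.ofReal (U ω ^ p) ∂P := by
    refine lintegral_congr fun ω ↦ ?_
    rw [Real.enorm_of_nonneg (hU0 ω), ENNReal.ofReal_rpow_of_nonneg (hU0 ω) hp.le]
  have h2 : ∫⁻ ω, ENNReal.ofReal (U ω ^ p) ∂P ≤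
      ENNReal.ofReal (p * (Real.exp (1 / 2) * Real.Gamma p)) := by
    rw [lintegral_rpow_eq_lintegral_meas_le_mul P (ae_of_all _ hU0) hU.aemeasurable hp,
      ENNReal.ofReal_mul hp.le]
    gcongr
    calc ∫⁻ t in Ioi (0 : ℝ), P {a | t ≤ U a} * ENNReal.ofReal (t ^ (p - 1))
        ≤ ∫⁻ t in Ioi (0 : ℝ), ENNReal.ofReal (Real.exp (1 / 2)) *
            ENNReal.ofReal (Real.exp (-t) * t ^ (p - 1)) := by
          refine setLIntegral_mono' measurableSet_Ioi fun t ht ↦ ?_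
          rw [ENNReal.ofReal_mul (Real.exp_pos _).le, ← mul_assoc,
            ← ENNReal.ofReal_mul (Real.exp_pos _).le]
          gcongr
          exact htail t ht
      _ = ENNReal.ofReal (Real.exp (1 / 2) * Real.Gamma p) := by
          rw [lintegral_const_mul' _ _ ENNReal.ofReal_ne_top,
            ← ofReal_integral_eq_lintegral_ofReal hG, ← Real.Gamma_eq_integral hp,
            ← ENNReal.ofReal_mul (Real.exp_pos _).le]
          filter_upwards [ae_restrict_mem measurableSet_Ioi] with t ht
          exact mul_nonneg (Real.exp_pos _).le (Real.rpow_nonneg (le_of_lt ht) _)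
  rw [h1, momentConst, ← ENNReal.ofReal_rpow_of_nonneg (by positivity) (by positivity)]
  gcongr

/-- Independence and centering make the partial sums a martingale; conditional Jensen for the convex
map `x ↦ exp (r x)` does the rest. -/
theorem submartingale_exp_sum [IsProbabilityMeasure P] {X : ℕ → Ω → ℝ} (hX : ∀ j, Measurable (X j))
    (hi : iIndepFun X P) {c : NNReal} (hs : ∀ j, HasSubgaussianMGF (X j) c P)
    (h0 : ∀ j, ∫ ω, X j ω ∂P = 0) (r : ℝ) :
    Submartingale (fun k ω ↦ Real.exp (r * ∑ j ∈ Finset.range (k + 1), X j ω))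
      (Filtration.natural X fun j ↦ (hX j).stronglyMeasurable) P := by
  set F := Filtration.natural X fun j ↦ (hX j).stronglyMeasurable
  have hS : ∀ k, StronglyMeasurable[F k] (fun ω ↦ ∑ j ∈ Finset.range (k + 1), X j ω) := by
    intro k
    refine Finset.stronglyMeasurable_fun_sum _ fun j hj ↦ ?_
    exact (Filtration.stronglyAdapted_natural (fun j ↦ (hX j).stronglyMeasurable) j).mono
      (F.mono (Nat.lt_succ_iff.1 (Finset.mem_range.1 hj)))
  have hsum : ∀ s : Finset ℕ, HasSubgaussianMGF (fun ω ↦ ∑ j ∈ s, X j ω) (∑ j ∈ s, c) P :=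
    fun s ↦ HasSubgaussianMGF.sum_of_iIndepFun hi fun j _ ↦ hs j
  have hconv : ConvexOn ℝ univ fun x : ℝ ↦ Real.exp (r * x) := by
    have := convexOn_exp.comp_linearMap (LinearMap.lsmul ℝ ℝ r)
    simpa [Function.comp_def] using this
  refine submartingale_nat (fun k ↦ ?_) (fun k ↦ (hsum _).integrable_exp_mul r) fun k ↦ ?_
  · exact Real.continuous_exp.comp_stronglyMeasurable ((hS k).const_mul r)
  · have hJ := hconv.map_condExp_le_univ (F.le k) (μ := P)
      (by fun_prop : Continuous fun x : ℝ ↦ Real.exp (r * x)).lowerSemicontinuous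
      (hsum (Finset.range (k + 1 + 1))).integrable ((hsum _).integrable_exp_mul r)
    have hc : P[fun ω ↦ ∑ j ∈ Finset.range (k + 1 + 1), X j ω | F k] =ᵐ[P]
        fun ω ↦ ∑ j ∈ Finset.range (k + 1), X j ω := by
      have e : (fun ω ↦ ∑ j ∈ Finset.range (k + 1 + 1), X j ω) =
          (fun ω ↦ ∑ j ∈ Finset.range (k + 1), X j ω) + X (k + 1) := by
        ext ω; simp [Finset.sum_range_succ]
      rw [e]
      refine (condExp_add (hsum _).integrable (hs _).integrable _).trans ?_
      have e1 := condExp_of_stronglyMeasurable (F.le k) (hS k) (hsum _).integrable (μ := P)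
      have e2 := hi.condExp_natural_ae_eq_of_lt (fun j ↦ (hX j).stronglyMeasurable)
        (Nat.lt_succ_self k)
      filter_upwards [e2] with ω h2
      rw [Pi.add_apply, e1, h2, Nat.succ_eq_add_one, h0, add_zero]
    filter_upwards [hJ, hc] with ω h1 h2
    rw [Function.comp_apply, h2] at h1
    exact h1

/-- Maximal inequality for partial sums of bounded, centered, independent random variables. -/
theorem exists_dominating_partial_sums [IsProbabilityMeasure P] {X : ℕ → Ω → ℝ}
    (hX : ∀ j, Measurable (X j)) (hi : iIndepFun X P) (h0 : ∀ j, ∫ ω, X j ω ∂P = 0)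
    {c : ℝ} (hc : 0 < c) (hb : ∀ j, ∀ᵐ ω ∂P, |X j ω| ≤ c) {n : ℕ} (hn : 1 ≤ n)
    {p : ℝ} (hp : 0 < p) :
    ∃ D : Ω → ℝ, Measurable D ∧ (∀ ω, ∀ k ≤ n, ∑ j ∈ Finset.range k, X j ω ≤ D ω) ∧
      eLpNorm D (ENNReal.ofReal p) P ≤ ENNReal.ofReal (√n * c * momentConst p) := by
  obtain ⟨m, rfl⟩ : ∃ m, n = m + 1 := ⟨n - 1, by omega⟩
  -- Hoeffding's lemma on `[-c, c]`: half the length of the interval, squared, is `c²`.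
  have hs : ∀ j, HasSubgaussianMGF (X j) (c.toNNReal ^ 2) P := by
    intro j
    have := hasSubgaussianMGF_of_mem_Icc_of_integral_eq_zero (a := -c) (b := c)
      (hX j).aemeasurable ((hb j).mono fun ω h ↦ abs_le.1 h) (h0 j)
    convert this using 2
    ext
    rw [sub_neg_eq_add, Real.coe_toNNReal _ hc.le, NNReal.coe_div, coe_nnnorm, Real.norm_eq_abs,
      abs_of_pos (by linarith), NNReal.coe_ofNat]
    ring
  -- At the scale `q = √n c` the sub-Gaussian bound for `E exp(S_n / q)` is `exp(n c² / (2 q²)) =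
  -- exp(1/2)`.
  set q : ℝ := √((m + 1 : ℕ) : ℝ) * c with hq
  have hq0 : 0 < q := by positivity
  have hsub := submartingale_exp_sum hX hi hs h0 q⁻¹
  set G : Ω → ℝ := fun ω ↦ (Finset.range (m + 1)).sup' Finset.nonempty_range_add_one
    fun k ↦ ∑ j ∈ Finset.range (k + 1), X j ω with hG
  have hGm : Measurable G := by
    have := Finset.measurable_sup' (s := Finset.range (m + 1)) Finset.nonempty_range_add_one
      (f := fun k ω ↦ ∑ j ∈ Finset.range (k + 1), X j ω)
      (fun k _ ↦ Finset.measurable_fun_sum _ fun j _ ↦ hX j)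
    convert this using 1
    ext ω
    simp [hG, Finset.sup'_apply]
  have hle : ∀ ω, ∀ k < m + 1, ∑ j ∈ Finset.range (k + 1), X j ω ≤ G ω := fun ω k hk ↦
    Finset.le_sup' (fun k ↦ ∑ j ∈ Finset.range (k + 1), X j ω) (Finset.mem_range.2 hk)
  have hmgf : ∫ ω, Real.exp (q⁻¹ * ∑ j ∈ Finset.range (m + 1), X j ω) ∂P ≤ Real.exp (1 / 2) := by
    refine ((HasSubgaussianMGF.sum_of_iIndepFun hi (s := Finset.range (m + 1))
      fun j _ ↦ hs j).mgf_le q⁻¹).trans (Real.exp_le_exp.2 (le_of_eq ?_))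
    have e : q ^ 2 = (m + 1) * c ^ 2 := by
      rw [hq, mul_pow, Real.sq_sqrt (Nat.cast_nonneg _)]; push_cast; ring
    simp only [Finset.sum_const, Finset.card_range, nsmul_eq_mul, NNReal.coe_mul, NNReal.coe_natCast,
      NNReal.coe_pow, Real.coe_toNNReal _ hc.le, inv_pow, e]
    push_cast
    field_simp
  -- Doob's inequality for `exp (S_k / q)` at level `exp t`.
  have htail : ∀ t : ℝ, 0 < t → P {ω | t ≤ max (q⁻¹ * G ω) 0} ≤
      ENNReal.ofReal (Real.exp (1 / 2) * Real.exp (-t)) := by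
    intro t ht
    have hmax := maximal_ineq hsub (fun k ω ↦ (Real.exp_pos _).le)
      (ε := (Real.exp t).toNNReal) m
    rw [Real.coe_toNNReal _ (Real.exp_pos t).le] at hmax
    set A := {ω | Real.exp t ≤
      (Finset.range (m + 1)).sup' Finset.nonempty_range_add_one
        fun k ↦ Real.exp (q⁻¹ * ∑ j ∈ Finset.range (k + 1), X j ω)}
    have hsubset : {ω | t ≤ max (q⁻¹ * G ω) 0} ⊆ A := by
      intro ω hω
      have h1 : t ≤ q⁻¹ * G ω := (le_max_iff.1 hω).resolve_right (not_le.2 ht)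
      obtain ⟨k, hk, hk'⟩ := Finset.exists_mem_eq_sup' (s := Finset.range (m + 1))
        Finset.nonempty_range_add_one fun k ↦ ∑ j ∈ Finset.range (k + 1), X j ω
      refine le_trans ?_ (Finset.le_sup' (fun k ↦ Real.exp (q⁻¹ *
        ∑ j ∈ Finset.range (k + 1), X j ω)) hk)
      rw [← hk']
      exact Real.exp_le_exp.2 h1
    have hint : ∫ ω in A, Real.exp (q⁻¹ * ∑ j ∈ Finset.range (m + 1), X j ω) ∂P ≤
        Real.exp (1 / 2) :=
      (setIntegral_le_integral (hsub.integrable m) (ae_of_all _ fun ω ↦ (Real.exp_pos _).le)).trans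
        hmgf
    have h2 : ENNReal.ofReal (Real.exp t) * P A ≤ ENNReal.ofReal (Real.exp (1 / 2)) :=
      hmax.trans (ENNReal.ofReal_le_ofReal hint)
    calc P {ω | t ≤ max (q⁻¹ * G ω) 0} ≤ P A := measure_mono hsubset
      _ = ENNReal.ofReal (Real.exp (-t)) * (ENNReal.ofReal (Real.exp t) * P A) := by
          rw [← mul_assoc, ← ENNReal.ofReal_mul (Real.exp_pos _).le, ← Real.exp_add]
          simp
      _ ≤ ENNReal.ofReal (Real.exp (-t)) * ENNReal.ofReal (Real.exp (1 / 2)) := by gcongr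
      _ = _ := by rw [← ENNReal.ofReal_mul (Real.exp_pos _).le, mul_comm]
  have hUm : Measurable fun ω ↦ max (q⁻¹ * G ω) 0 := (hGm.const_mul _).max measurable_const
  -- `G` covers only the sums with at least one term; the maximum with `0` accounts for the empty
  -- one.
  refine ⟨fun ω ↦ q * max (q⁻¹ * G ω) 0, hUm.const_mul _, fun ω k hk ↦ ?_, ?_⟩
  · rcases k with _ | k
    · simpa using mul_nonneg hq0.le (le_max_right _ _)
    · calc _ ≤ G ω := hle ω k (by omega)
        _ = q * (q⁻¹ * G ω) := by field_simp
        _ ≤ _ := mul_le_mul_of_nonneg_left (le_max_left _ _) hq0.le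
  · have := eLpNorm_const_smul q (fun ω ↦ max (q⁻¹ * G ω) 0) (ENNReal.ofReal p) P
    simp only [Pi.smul_def, smul_eq_mul] at this
    rw [this, Real.enorm_of_nonneg hq0.le, ENNReal.ofReal_mul hq0.le]
    gcongr
    exact eLpNorm_le_momentConst hUm (fun ω ↦ le_max_right _ _) hp htail

end MaximalInequality

/-! ### Maximal inequality for vector sums -/

section VectorMaximalInequality

variable {Ω : Type*} [MeasurableSpace Ω] {P : Measure Ω}

theorem norm_le_sum_abs {d : ℕ} (v : EuclideanSpace ℝ (Fin d)) : ‖v‖ ≤ ∑ i, |v i| := by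
  rw [EuclideanSpace.norm_eq]
  refine Real.sqrt_le_iff.2 ⟨Finset.sum_nonneg fun i _ ↦ abs_nonneg _, ?_⟩
  simpa using Finset.sum_sq_le_sq_sum_of_nonneg fun i (_ : i ∈ Finset.univ) ↦ abs_nonneg (v i)

/-- Maximal inequality for partial sums of bounded, centered, independent random vectors. -/
theorem exists_dominating_norm_partial_sums [IsProbabilityMeasure P] {d : ℕ}
    {X : ℕ → Ω → EuclideanSpace ℝ (Fin d)}
    (hX : ∀ j, Measurable (X j)) (hi : iIndepFun X P) (h0 : ∀ j, ∫ ω, X j ω ∂P = 0)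
    {c : ℝ} (hc : 0 < c) (hb : ∀ j, ∀ᵐ ω ∂P, ‖X j ω‖ ≤ c) {n : ℕ} (hn : 1 ≤ n)
    {p : ℝ} (hp : 1 ≤ p) :
    ∃ D : Ω → ℝ, Measurable D ∧ (∀ ω, ∀ k ≤ n, ‖∑ j ∈ Finset.range k, X j ω‖ ≤ D ω) ∧
      eLpNorm D (ENNReal.ofReal p) P ≤ ENNReal.ofReal (d * (2 * (√n * c * momentConst p))) := by
  have hp0 : 0 < p := by linarith
  have hp1 : 1 ≤ ENNReal.ofReal p := by simpa using hp
  have hproj : ∀ i : Fin d, Measurable fun v : EuclideanSpace ℝ (Fin d) ↦ v i := fun i ↦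
    (EuclideanSpace.proj (𝕜 := ℝ) i).continuous.measurable
  have hcoord : ∀ j i, ∫ ω, X j ω i ∂P = 0 := fun j i ↦ by
    have := (EuclideanSpace.proj (𝕜 := ℝ) i).integral_comp_comm
      (Integrable.of_bound (hX j).aestronglyMeasurable c (hb j))
    simpa [h0 j] using this
  have hbi : ∀ j i, ∀ᵐ ω ∂P, |X j ω i| ≤ c := fun j i ↦
    (hb j).mono fun ω h ↦ (PiLp.norm_apply_le (X j ω) i).trans h
  -- The scalar bound is one-sided, so it is applied to each coordinate and to its negative.
  have hpos : ∀ i : Fin d, _ := fun i ↦ exists_dominating_partial_sums (P := P)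
    (X := fun j ω ↦ X j ω i) (fun j ↦ (hproj i).comp (hX j))
    (hi.comp (fun _ v ↦ v i) fun _ ↦ hproj i) (fun j ↦ hcoord j i) hc (fun j ↦ hbi j i) hn hp0
  have hneg : ∀ i : Fin d, _ := fun i ↦ exists_dominating_partial_sums (P := P)
    (X := fun j ω ↦ -X j ω i) (fun j ↦ ((hproj i).comp (hX j)).neg)
    (hi.comp (fun _ v ↦ -v i) fun _ ↦ (hproj i).neg)
    (fun j ↦ by rw [integral_neg, hcoord j i, neg_zero]) hc
    (fun j ↦ by simpa using hbi j i) hn hp0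
  choose U hUm hU hUn using hpos
  choose V hVm hV hVn using hneg
  refine ⟨∑ i, (U i + V i),
    by rw [Finset.sum_fn]; exact Finset.measurable_sum _ fun i _ ↦ (hUm i).add (hVm i),
    fun ω k hk ↦ (norm_le_sum_abs _).trans ?_, ?_⟩
  · rw [Finset.sum_apply]
    refine Finset.sum_le_sum fun i _ ↦ ?_
    have h1 := hU i ω k hk
    have h2 := hV i ω k hk
    -- The empty sum shows `U i` and `V i` to be nonnegative, so `U i + V i` dominates both signs.
    have h3 := hU i ω 0 (Nat.zero_le _)
    have h4 := hV i ω 0 (Nat.zero_le _)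
    simp only [Finset.range_zero, Finset.sum_empty, Finset.sum_neg_distrib] at h2 h3 h4
    have e : (∑ j ∈ Finset.range k, X j ω) i = ∑ j ∈ Finset.range k, X j ω i := by
      simp
    rw [e, Pi.add_apply]
    exact abs_le.2 ⟨by linarith, by linarith⟩
  · have hq : 0 ≤ √n * c * momentConst p :=
      mul_nonneg (by positivity) (momentConst_nonneg hp0)
    calc eLpNorm (∑ i, (U i + V i)) (ENNReal.ofReal p) P
        ≤ ∑ i, eLpNorm (U i + V i) (ENNReal.ofReal p) P :=
          eLpNorm_sum_le (fun i _ ↦ ((hUm i).add (hVm i)).aestronglyMeasurable) hp1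
      _ ≤ ∑ _i : Fin d, ENNReal.ofReal (2 * (√n * c * momentConst p)) := by
          refine Finset.sum_le_sum fun i _ ↦ ?_
          refine (eLpNorm_add_le (hUm i).aestronglyMeasurable (hVm i).aestronglyMeasurable
            hp1).trans ?_
          rw [two_mul, ENNReal.ofReal_add hq hq]
          exact add_le_add (hUn i) (hVn i)
      _ = _ := by
          rw [Finset.sum_const, Finset.card_univ, Fintype.card_fin, nsmul_eq_mul,
            ENNReal.ofReal_mul (Nat.cast_nonneg d), ENNReal.ofReal_natCast]

end VectorMaximalInequality

/-! ### Pathwise error analysis -/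

section Deterministic

theorem step_pos {a b : ℝ} (hab : a < b) {n : ℕ} (hn : 1 ≤ n) : 0 < step a b n :=
  div_pos (sub_pos.2 hab) (by exact_mod_cast hn)

theorem natCast_mul_step {a b : ℝ} {n : ℕ} (hn : 1 ≤ n) : n * step a b n = b - a := by
  have : (n : ℝ) ≠ 0 := by positivity
  unfold step
  field_simp

theorem natCast_mul_step_le {a b : ℝ} (hab : a < b) {n k : ℕ} (hn : 1 ≤ n) (hk : k ≤ n) :
    k * step a b n ≤ b - a := by
  rw [← natCast_mul_step (a := a) (b := b) hn]
  exact mul_le_mul_of_nonneg_right (by exact_mod_cast hk) (step_pos hab hn).le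

theorem grid_succ (a b : ℝ) (n k : ℕ) : grid a b n (k + 1) = grid a b n k + step a b n := by
  unfold grid; push_cast; ring

theorem grid_mem_Icc {a b : ℝ} (hab : a < b) {n k : ℕ} (hn : 1 ≤ n) (hk : k ≤ n) :
    grid a b n k ∈ Icc a b := by
  have h1 := natCast_mul_step_le hab hn hk
  have h2 := mul_nonneg (Nat.cast_nonneg (α := ℝ) k) (step_pos hab hn).le
  unfold grid
  exact ⟨by linarith, by linarith⟩

theorem node_mem_Icc {a b : ℝ} (hab : a < b) {n k : ℕ} (hk : k < n) {τ : ℕ → ℝ}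
    (hτ : τ k ∈ Icc (0 : ℝ) 1) : node a b n τ k ∈ Icc a b := by
  have hn : 1 ≤ n := by omega
  have hh := step_pos hab hn
  have h1 := grid_mem_Icc hab hn hk.le
  have h2 := grid_mem_Icc hab hn hk
  rw [grid_succ] at h2
  have h3 := mul_nonneg hh.le hτ.1
  have h4 := mul_le_of_le_one_right hh.le hτ.2
  unfold node
  exact ⟨by linarith [h1.1], by linarith [h2.2]⟩

/-- Every point of `[a,b]` lies in the grid cell selected by `interp`. -/
theorem sub_grid_mem_Icc {a b : ℝ} (hab : a < b) {n : ℕ} (hn : 1 ≤ n) {t : ℝ} (ht : t ∈ Icc a b) :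
    t - grid a b n (min ⌊(t - a) / step a b n⌋₊ (n - 1)) ∈ Icc 0 (step a b n) := by
  have hh := step_pos hab hn
  have h0 : 0 ≤ (t - a) / step a b n := div_nonneg (by linarith [ht.1]) hh.le
  have hfl := Nat.floor_le h0
  rw [le_div_iff₀ hh] at hfl
  have hlt := Nat.lt_floor_add_one ((t - a) / step a b n)
  rw [div_lt_iff₀ hh] at hlt
  rcases le_total ⌊(t - a) / step a b n⌋₊ (n - 1) with h | h
  · rw [min_eq_left h]
    unfold grid
    constructor <;> linarith
  -- The cap `n - 1` puts `t = b`, where the floor is `n`, into the last cell.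
  · rw [min_eq_right h]
    have e := natCast_mul_step (a := a) (b := b) hn
    obtain ⟨m, rfl⟩ : ∃ m, n = m + 1 := ⟨n - 1, by omega⟩
    have h' : (m : ℝ) ≤ ⌊(t - a) / step a b (m + 1)⌋₊ := by exact_mod_cast h
    have h'' := mul_le_mul_of_nonneg_right h' hh.le
    simp only [Nat.add_sub_cancel]
    push_cast at e
    unfold grid
    constructor
    · linarith
    · linarith [ht.2]

/-- Discrete Gronwall: the right-hand side of `hu`, rather than `u`, grows by a factor of at most `1
+ c ≤ exp c` per step. -/
theorem le_mul_exp_of_le_add_sum {u : ℕ → ℝ} {A c : ℝ} (hc : 0 ≤ c) {n : ℕ}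
    (hu : ∀ k ≤ n, u k ≤ A + c * ∑ j ∈ Finset.range k, u j) (hA : 0 ≤ A) {k : ℕ} (hk : k ≤ n) :
    u k ≤ A * Real.exp (c * k) := by
  have hW : ∀ k ≤ n, A + c * ∑ j ∈ Finset.range k, u j ≤ A * Real.exp (c * k) := by
    intro k
    induction k with
    | zero => simp
    | succ k ih =>
      intro hk
      have h1 := ih (by omega)
      have h2 := hu k (by omega)
      rw [Finset.sum_range_succ]
      calc A + c * (∑ j ∈ Finset.range k, u j + u k)
          = (A + c * ∑ j ∈ Finset.range k, u j) + c * u k := by ring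
        _ ≤ A * Real.exp (c * k) + c * (A * Real.exp (c * k)) := by
            gcongr
            exact h2.trans h1
        _ = A * Real.exp (c * k) * (c + 1) := by ring
        _ ≤ A * Real.exp (c * k) * Real.exp c := by
            gcongr
            exact Real.add_one_le_exp c
        _ = A * Real.exp (c * (k + 1 : ℕ)) := by
            rw [mul_assoc, ← Real.exp_add]; push_cast; ring_nf
  exact (hu k hk).trans (hW k hk)

variable {d : ℕ}

/-- The quadrature error `∫_{t_k}^{t_{k+1}} g(s, z(t_k)) ds - h g(t_k + h u, z(t_k))`. -/
noncomputable def quadError (a b : ℝ) (g : ℝ → EuclideanSpace ℝ (Fin d) → EuclideanSpace ℝ (Fin d))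
    (z : ℝ → EuclideanSpace ℝ (Fin d)) (n k : ℕ) (u : ℝ) : EuclideanSpace ℝ (Fin d) :=
  (∫ s in (grid a b n k)..(grid a b n (k + 1)), g s (z (grid a b n k))) -
    step a b n • g (grid a b n k + step a b n * u) (z (grid a b n k))

variable {a b : ℝ} {g : ℝ → EuclideanSpace ℝ (Fin d) → EuclideanSpace ℝ (Fin d)}
  {ξ : EuclideanSpace ℝ (Fin d)} {z : ℝ → EuclideanSpace ℝ (Fin d)}

theorem continuous_smul_comp_add_mul (hg : Continuous (Function.uncurry g)) (c h : ℝ)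
    (x : EuclideanSpace ℝ (Fin d)) : Continuous fun u : ℝ ↦ h • g (c + h * u) x :=
  (hg.comp (by fun_prop : Continuous fun u : ℝ ↦ (c + h * u, x))).const_smul h

theorem continuous_quadError (hg : Continuous (Function.uncurry g)) (n k : ℕ) :
    Continuous (quadError a b g z n k) :=
  continuous_const.sub (continuous_smul_comp_add_mul hg _ _ _)

/-- Substituting `s = t_k + h u` shows that a uniform sample is an unbiased quadrature; this
centering is what gains the extra half order. -/
theorem integral_quadError (hg : Continuous (Function.uncurry g)) (n k : ℕ) :
    ∫ u in (0 : ℝ)..1, quadError a b g z n k u = 0 := by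
  unfold quadError
  rw [intervalIntegral.integral_sub intervalIntegrable_const
    ((continuous_smul_comp_add_mul hg _ _ _).intervalIntegrable _ _),
    intervalIntegral.integral_const, intervalIntegral.integral_smul,
    intervalIntegral.smul_integral_comp_add_mul (fun s ↦ g s (z (grid a b n k)))]
  simp [grid_succ]

/-- The integration variable and the sample point share a cell, so the Hölder bound costs at most `H
h^ϱ` over a length `h`. -/
theorem norm_quadError_le (hab : a < b) (hg : Continuous (Function.uncurry g)) {H ϱ : ℝ}
    (hϱ : 0 ≤ ϱ) (hH0 : 0 ≤ H) (hH : ∀ t s x, ‖g t x - g s x‖ ≤ H * |t - s| ^ ϱ) {n : ℕ} (hn : 1 ≤ n)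
    (k : ℕ) {u : ℝ} (hu : u ∈ Icc (0 : ℝ) 1) :
    ‖quadError a b g z n k u‖ ≤ H * step a b n ^ ϱ * step a b n := by
  have hh := step_pos hab hn
  set t₀ := grid a b n k with ht₀
  set h := step a b n
  have hc : Continuous fun s : ℝ ↦ g s (z t₀) :=
    hg.comp (by fun_prop : Continuous fun s : ℝ ↦ (s, z t₀))
  have e : quadError a b g z n k u =
      ∫ s in t₀..(t₀ + h), (g s (z t₀) - g (t₀ + h * u) (z t₀)) := by
    unfold quadError
    rw [intervalIntegral.integral_sub (hc.intervalIntegrable _ _) intervalIntegrable_const,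
      intervalIntegral.integral_const, grid_succ, ← ht₀, add_sub_cancel_left]
  rw [e]
  refine (intervalIntegral.norm_integral_le_of_norm_le_const (C := H * h ^ ϱ) fun s hs ↦ ?_).trans
    (by rw [add_sub_cancel_left, abs_of_pos hh])
  rw [uIoc_of_le (by linarith)] at hs
  refine (hH _ _ _).trans ?_
  have h1 := mul_nonneg hh.le hu.1
  have h2 := mul_le_of_le_one_right hh.le hu.2
  have : |s - (t₀ + h * u)| ≤ h := abs_le.2 ⟨by linarith [hs.1], by linarith [hs.2]⟩
  gcongr

theorem norm_solution_sub_le {M : ℝ} (hM : ∀ t x, ‖g t x‖ ≤ M) (hz : IsSolution a b g ξ z)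
    {s t : ℝ} (hs : s ∈ Icc a b) (ht : t ∈ Icc a b) : ‖z t - z s‖ ≤ M * |t - s| :=
  (convex_Icc a b).norm_image_sub_le_of_norm_hasDerivWithin_le hz.2 (fun _ _ ↦ hM _ _) hs ht

/-- The function `z t - ∫ g(s, z t₀)` has derivative `g(t, z t) - g(t, z t₀)`, at most `L M h`
because `z` is `M`-Lipschitz; the mean value inequality supplies the second `h`. -/
theorem norm_solution_step_le (hab : a < b) (hg : Continuous (Function.uncurry g)) {L M : ℝ}
    (hL0 : 0 ≤ L) (hM0 : 0 ≤ M)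
    (hL : ∀ t x y, ‖g t x - g t y‖ ≤ L * ‖x - y‖) (hM : ∀ t x, ‖g t x‖ ≤ M)
    (hz : IsSolution a b g ξ z) {n k : ℕ} (hk : k < n) :
    ‖z (grid a b n (k + 1)) - z (grid a b n k) -
      ∫ s in (grid a b n k)..(grid a b n (k + 1)), g s (z (grid a b n k))‖ ≤
      L * M * step a b n * step a b n := by
  have hn : 1 ≤ n := by omega
  have hh := step_pos hab hn
  have h0 := grid_mem_Icc hab hn hk.le
  have h1 := grid_mem_Icc hab hn hk
  rw [grid_succ] at h1 ⊢
  set t₀ := grid a b n k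
  set h := step a b n
  have hsub : Icc t₀ (t₀ + h) ⊆ Icc a b := Icc_subset_Icc h0.1 h1.2
  have hc : Continuous fun s : ℝ ↦ g s (z t₀) :=
    hg.comp (by fun_prop : Continuous fun s : ℝ ↦ (s, z t₀))
  have hd : ∀ t ∈ Icc t₀ (t₀ + h), HasDerivWithinAt
      (fun t ↦ z t - ∫ s in t₀..t, g s (z t₀)) (g t (z t) - g t (z t₀)) (Icc t₀ (t₀ + h)) t :=
    fun t ht ↦ ((hz.2 t (hsub ht)).mono hsub).sub
      (hc.integral_hasStrictDerivAt t₀ t).hasDerivAt.hasDerivWithinAt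
  have hb : ∀ t ∈ Icc t₀ (t₀ + h), ‖g t (z t) - g t (z t₀)‖ ≤ L * M * h := fun t ht ↦ by
    refine (hL _ _ _).trans ?_
    rw [mul_assoc]
    refine mul_le_mul_of_nonneg_left ?_ hL0
    refine (norm_solution_sub_le hM hz h0 (hsub ht)).trans ?_
    refine mul_le_mul_of_nonneg_left ?_ hM0
    exact abs_le.2 ⟨by linarith [ht.1], by linarith [ht.2]⟩
  have := (convex_Icc t₀ (t₀ + h)).norm_image_sub_le_of_norm_hasDerivWithin_le hd hb
    (left_mem_Icc.2 (by linarith)) (right_mem_Icc.2 (by linarith))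
  rw [intervalIntegral.integral_same, sub_zero, add_sub_cancel_left, Real.norm_eq_abs,
    abs_of_pos hh] at this
  refine le_trans (le_of_eq ?_) this
  congr 1
  abel

/-- Pathwise error bound in terms of the maximal accumulated quadrature error `D`. -/
theorem norm_solution_sub_interp_le (hab : a < b) (hg : Continuous (Function.uncurry g)) {L M : ℝ}
    (hL0 : 0 ≤ L) (hM0 : 0 ≤ M)
    (hL : ∀ t x y, ‖g t x - g t y‖ ≤ L * ‖x - y‖) (hM : ∀ t x, ‖g t x‖ ≤ M)
    (hz : IsSolution a b g ξ z) {n : ℕ} (hn : 1 ≤ n) (τ : ℕ → ℝ) {D : ℝ}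
    (hD : ∀ k ≤ n, ‖∑ j ∈ Finset.range k, quadError a b g z n j (τ j)‖ ≤ D)
    {t : ℝ} (ht : t ∈ Icc a b) :
    ‖z t - interp a b g ξ n τ t‖ ≤
      Real.exp (L * (b - a)) * D +
        (Real.exp (L * (b - a)) * ((b - a) * L * M) + 2 * M) * step a b n := by
  have hh := step_pos hab hn
  set h := step a b n with hh_def
  set y := euler a b g ξ n τ
  set e : ℕ → EuclideanSpace ℝ (Fin d) := fun k ↦ z (grid a b n k) - y k with he
  have hD0 : 0 ≤ D := (norm_nonneg _).trans (hD 0 (Nat.zero_le _))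
  -- The accumulated quadrature error is subtracted before norms are taken, which preserves its
  -- cancellation.
  have hacc : ∀ k ≤ n, ‖e k - ∑ j ∈ Finset.range k, quadError a b g z n j (τ j)‖ ≤
      ∑ j ∈ Finset.range k, (L * M * h * h + h * L * ‖e j‖) := by
    intro k
    induction k with
    | zero =>
      intro _
      simp [he, y, euler, grid, hz.1]
    | succ k ih =>
      intro hk
      have hy : y (k + 1) = y k + h • g (node a b n τ k) (y k) := rfl
      have hr := norm_solution_step_le hab hg hL0 hM0 hL hM hz hk
      have hl : ‖h • (g (node a b n τ k) (z (grid a b n k)) - g (node a b n τ k) (y k))‖ ≤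
          h * L * ‖e k‖ := by
        rw [norm_smul, Real.norm_eq_abs, abs_of_pos hh, mul_assoc]
        exact mul_le_mul_of_nonneg_left (hL _ _ _) hh.le
      rw [Finset.sum_range_succ, Finset.sum_range_succ]
      have key : e (k + 1) - (∑ j ∈ Finset.range k, quadError a b g z n j (τ j) +
            quadError a b g z n k (τ k)) =
          (e k - ∑ j ∈ Finset.range k, quadError a b g z n j (τ j)) +
          ((z (grid a b n (k + 1)) - z (grid a b n k) -
            ∫ s in (grid a b n k)..(grid a b n (k + 1)), g s (z (grid a b n k))) +
          h • (g (node a b n τ k) (z (grid a b n k)) - g (node a b n τ k) (y k))) := by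
        simp only [he, hy, quadError, ← hh_def, node, smul_sub]
        abel
      rw [key]
      exact (norm_add_le _ _).trans (add_le_add (ih (by omega))
        ((norm_add_le _ _).trans (add_le_add hr hl)))
  have hrec : ∀ k ≤ n, ‖e k‖ ≤ (D + (b - a) * L * M * h) +
      (h * L) * ∑ j ∈ Finset.range k, ‖e j‖ := by
    intro k hk
    have h1 := hacc k hk
    have h2 := hD k hk
    have h3 : ‖e k‖ ≤ ‖e k - ∑ j ∈ Finset.range k, quadError a b g z n j (τ j)‖ +
        ‖∑ j ∈ Finset.range k, quadError a b g z n j (τ j)‖ := by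
      simpa using norm_add_le (e k - ∑ j ∈ Finset.range k, quadError a b g z n j (τ j))
        (∑ j ∈ Finset.range k, quadError a b g z n j (τ j))
    rw [Finset.sum_add_distrib, Finset.sum_const, Finset.card_range, nsmul_eq_mul,
      ← Finset.mul_sum] at h1
    have h4 : (k : ℝ) * (L * M * h * h) ≤ (b - a) * L * M * h := by
      calc (k : ℝ) * (L * M * h * h) = (k * h) * (L * M * h) := by ring
        _ ≤ (b - a) * (L * M * h) :=
          mul_le_mul_of_nonneg_right (natCast_mul_step_le hab hn hk) (by positivity)
        _ = _ := by ring
    linarith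
  have hA : 0 ≤ D + (b - a) * L * M * h := by
    have : 0 < b - a := sub_pos.2 hab
    positivity
  have hek : ∀ k ≤ n, ‖e k‖ ≤ Real.exp (L * (b - a)) * (D + (b - a) * L * M * h) := by
    intro k hk
    refine (le_mul_exp_of_le_add_sum (by positivity) hrec hA hk).trans ?_
    rw [mul_comm]
    refine mul_le_mul_of_nonneg_right (Real.exp_le_exp.2 ?_) hA
    calc h * L * k = L * (k * h) := by ring
      _ ≤ _ := mul_le_mul_of_nonneg_left (natCast_mul_step_le hab hn hk) hL0
  -- Inside a cell `z` and the interpolant each move by at most `M h`, hence the `2 * M`.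
  have hcell := sub_grid_mem_Icc hab hn ht
  unfold interp piece
  set k := min ⌊(t - a) / step a b n⌋₊ (n - 1)
  have hk : k ≤ n := (min_le_right _ _).trans (Nat.sub_le _ _)
  have h1 := norm_solution_sub_le hM hz (grid_mem_Icc hab hn hk) ht
  have h2 : |t - grid a b n k| ≤ h := by rw [abs_of_nonneg hcell.1]; exact hcell.2
  have h3 : ‖z t - z (grid a b n k)‖ ≤ M * h := h1.trans (mul_le_mul_of_nonneg_left h2 hM0)
  have h4 : ‖(t - grid a b n k) • g (node a b n τ k) (y k)‖ ≤ M * h := by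
    rw [norm_smul, Real.norm_eq_abs, mul_comm]
    exact mul_le_mul (hM _ _) h2 (abs_nonneg _) hM0
  have key : z t - (y k + (t - grid a b n k) • g (node a b n τ k) (y k)) =
      (z t - z (grid a b n k)) + e k - (t - grid a b n k) • g (node a b n τ k) (y k) := by
    simp only [he]; abel
  rw [key]
  have h5 := norm_sub_le (z t - z (grid a b n k) + e k)
    ((t - grid a b n k) • g (node a b n τ k) (y k))
  have h6 := norm_add_le (z t - z (grid a b n k)) (e k)
  have h7 := hek k hk
  linarith

end Deterministic

/-! ### Truncation of the field, a priori bounds and solvability -/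

section Truncation

variable {d : ℕ}

/-- Coordinatewise projection onto the cube `[-R, R]^d`. -/
noncomputable def clamp (R : ℝ) (x : EuclideanSpace ℝ (Fin d)) : EuclideanSpace ℝ (Fin d) :=
  WithLp.toLp 2 fun i ↦ max (-R) (min R (x i))

/-- Projection onto an interval is nonexpansive in each coordinate. The constant 1 lets truncation
keep both the Lipschitz and the growth constants. -/
theorem norm_clamp_sub_le (R : ℝ) (x y : EuclideanSpace ℝ (Fin d)) :
    ‖clamp R x - clamp R y‖ ≤ ‖x - y‖ := by
  rw [EuclideanSpace.norm_eq, EuclideanSpace.norm_eq]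
  refine Real.sqrt_le_sqrt (Finset.sum_le_sum fun i _ ↦ ?_)
  refine pow_le_pow_left₀ (norm_nonneg _) ?_ 2
  have h1 := abs_max_sub_max_le_max (-R) (min R (x i)) (-R) (min R (y i))
  have h2 := abs_min_sub_min_le_max R (x i) R (y i)
  rw [sub_self, abs_zero, max_eq_right (abs_nonneg (_ : ℝ))] at h1 h2
  exact h1.trans h2

theorem norm_clamp_le {R : ℝ} (hR : 0 ≤ R) (x : EuclideanSpace ℝ (Fin d)) : ‖clamp R x‖ ≤ ‖x‖ := by
  have h0 : clamp R (0 : EuclideanSpace ℝ (Fin d)) = 0 := by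
    ext i
    simp [clamp, hR]
  simpa [h0] using norm_clamp_sub_le R x 0

theorem norm_clamp_le_mul {R : ℝ} (hR : 0 ≤ R) (x : EuclideanSpace ℝ (Fin d)) :
    ‖clamp R x‖ ≤ d * R := by
  refine (norm_le_sum_abs _).trans ?_
  have : ∀ i ∈ Finset.univ, |clamp R x i| ≤ R := fun i _ ↦
    abs_le.2 ⟨le_max_left _ _, max_le (by linarith) (min_le_left _ _)⟩
  simpa using Finset.sum_le_sum this

theorem clamp_of_norm_le {R : ℝ} {x : EuclideanSpace ℝ (Fin d)} (hx : ‖x‖ ≤ R) :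
    clamp R x = x := by
  ext i
  have h := abs_le.1 ((PiLp.norm_apply_le x i).trans hx)
  simp [clamp, min_eq_right h.2, max_eq_right h.1]

theorem continuous_clamp (R : ℝ) :
    Continuous (clamp R : EuclideanSpace ℝ (Fin d) → EuclideanSpace ℝ (Fin d)) :=
  (LipschitzWith.of_dist_le_mul (K := 1) fun x y ↦ by
    simpa [dist_eq_norm] using norm_clamp_sub_le R x y).continuous

variable {a b : ℝ} {f : ℝ → EuclideanSpace ℝ (Fin d) → EuclideanSpace ℝ (Fin d)}

/-- A field with local regularity agrees on a given ball with a bounded, globally regular field of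
the same linear growth. -/
theorem exists_truncation (hab : a < b) {ϱ K : ℝ} (hϱ : 0 ≤ ϱ)
    (hA1 : ContinuousOn (Function.uncurry f) (Icc a b ×ˢ univ))
    (hK : 0 ≤ K) (hA2 : ∀ t ∈ Icc a b, ∀ y, ‖f t y‖ ≤ K * (1 + ‖y‖))
    (hA3 : ∀ R : ℝ, 0 < R → ∃ L : ℝ, 0 ≤ L ∧ ∀ t ∈ Icc a b, ∀ x y,
      ‖x‖ ≤ R → ‖y‖ ≤ R → ‖f t x - f t y‖ ≤ L * ‖x - y‖)
    (hA4 : ∀ H : ℝ, 0 < H → ∃ L : ℝ, 0 ≤ L ∧ ∀ t ∈ Icc a b, ∀ s ∈ Icc a b, ∀ x,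
      ‖x‖ ≤ H → ‖f t x - f s x‖ ≤ L * |t - s| ^ ϱ) {R : ℝ} (hR : 0 ≤ R) :
    ∃ (g : ℝ → EuclideanSpace ℝ (Fin d) → EuclideanSpace ℝ (Fin d)) (L M H : ℝ),
      Continuous (Function.uncurry g) ∧ 0 ≤ L ∧ 0 ≤ M ∧ 0 < H ∧
      (∀ t x y, ‖g t x - g t y‖ ≤ L * ‖x - y‖) ∧ (∀ t x, ‖g t x‖ ≤ M) ∧
      (∀ t s x, ‖g t x - g s x‖ ≤ H * |t - s| ^ ϱ) ∧
      (∀ t x, ‖g t x‖ ≤ K * (1 + ‖x‖)) ∧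
      ∀ t ∈ Icc a b, ∀ x, ‖x‖ ≤ R → g t x = f t x := by
  -- The cube has Euclidean radius at most `d * R`; the `+ 1` makes the radius positive, as `hA3`
  -- and `hA4` require.
  have hR' : 0 < d * R + 1 := by positivity
  have hcl : ∀ x : EuclideanSpace ℝ (Fin d), ‖clamp R x‖ ≤ d * R + 1 := fun x ↦ by
    linarith [norm_clamp_le_mul hR x]
  obtain ⟨L, hL0, hL⟩ := hA3 _ hR'
  obtain ⟨H, hH0, hH⟩ := hA4 _ hR'
  have hmem : ∀ t, (projIcc a b hab.le t : ℝ) ∈ Icc a b := fun t ↦ (projIcc a b hab.le t).2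
  -- Time is clamped too, so `g` is regular on all of `ℝ`. `H + 1` is positive, as the increment
  -- bound in the maximal inequality must be.
  refine ⟨fun t x ↦ f (projIcc a b hab.le t) (clamp R x), L, K * (1 + (d * R + 1)), H + 1,
    ?_, hL0, by positivity, by positivity, fun t x y ↦ ?_, fun t x ↦ ?_, fun t s x ↦ ?_,
    fun t x ↦ ?_, fun t ht x hx ↦ ?_⟩
  · have hc : Continuous fun q : ℝ × EuclideanSpace ℝ (Fin d) ↦
        ((projIcc a b hab.le q.1 : ℝ), clamp R q.2) :=
      (continuous_subtype_val.comp (continuous_projIcc.comp continuous_fst)).prodMk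
        ((continuous_clamp R).comp continuous_snd)
    exact hA1.comp_continuous hc fun q ↦ ⟨hmem _, mem_univ _⟩
  · exact (hL _ (hmem t) _ _ (hcl x) (hcl y)).trans
      (mul_le_mul_of_nonneg_left (norm_clamp_sub_le R x y) hL0)
  · refine (hA2 _ (hmem t) _).trans ?_
    gcongr
    exact hcl x
  · refine (hH _ (hmem t) _ (hmem s) _ (hcl x)).trans ?_
    have : |(projIcc a b hab.le t : ℝ) - projIcc a b hab.le s| ≤ |t - s| :=
      abs_projIcc_sub_projIcc hab.le
    gcongr
    linarith
  · refine (hA2 _ (hmem t) _).trans ?_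
    gcongr
    exact norm_clamp_le hR x
  · simp only [projIcc_of_mem hab.le ht, clamp_of_norm_le hx]

variable {ξ : EuclideanSpace ℝ (Fin d)}

theorem IsSolution.continuousOn {w : ℝ → EuclideanSpace ℝ (Fin d)} (hw : IsSolution a b f ξ w) :
    ContinuousOn w (Icc a b) := fun t ht ↦ (hw.2 t ht).continuousWithinAt

theorem IsSolution.hasDerivWithinAt_Ici {w : ℝ → EuclideanSpace ℝ (Fin d)}
    (hw : IsSolution a b f ξ w) {t : ℝ} (ht : t ∈ Ico a b) :
    HasDerivWithinAt w (f t (w t)) (Ici t) t :=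
  (hw.2 t (Ico_subset_Icc_self ht)).mono_of_mem_nhdsWithin (Icc_mem_nhdsGE_of_mem ht)

/-- Gronwall. Only `K` enters, so the same radius serves `f` and its truncation, and `R` can be
fixed before truncating. -/
theorem IsSolution.norm_le {K : ℝ} (hK : 0 ≤ K)
    (hA2 : ∀ t ∈ Icc a b, ∀ y, ‖f t y‖ ≤ K * (1 + ‖y‖))
    {w : ℝ → EuclideanSpace ℝ (Fin d)} (hw : IsSolution a b f ξ w) {t : ℝ} (ht : t ∈ Icc a b) :
    ‖w t‖ ≤ (1 + ‖ξ‖) * Real.exp (K * (b - a)) := by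
  have h1 := norm_le_gronwallBound_of_norm_deriv_right_le (δ := ‖ξ‖) (K := K) (ε := K)
    hw.continuousOn (fun x hx ↦ hw.hasDerivWithinAt_Ici hx) (by rw [hw.1])
    (fun x hx ↦ (hA2 x (Ico_subset_Icc_self hx) _).trans (le_of_eq (by ring))) t ht
  have hexp : Real.exp (K * (t - a)) ≤ Real.exp (K * (b - a)) :=
    Real.exp_le_exp.2 (mul_le_mul_of_nonneg_left (by linarith [ht.2]) hK)
  have h2 : gronwallBound ‖ξ‖ K K (t - a) ≤ (1 + ‖ξ‖) * Real.exp (K * (t - a)) := by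
    rcases eq_or_ne K 0 with rfl | hK0
    · simp [gronwallBound_K0]
    · rw [gronwallBound_of_K_ne_0 hK0, div_self hK0]
      linarith
  exact h1.trans (h2.trans (mul_le_mul_of_nonneg_left hexp (by positivity)))

theorem IsSolution.congr_field {g : ℝ → EuclideanSpace ℝ (Fin d) → EuclideanSpace ℝ (Fin d)} {R : ℝ}
    (hfg : ∀ t ∈ Icc a b, ∀ x, ‖x‖ ≤ R → g t x = f t x) {w : ℝ → EuclideanSpace ℝ (Fin d)}
    (hw : IsSolution a b f ξ w) (hR : ∀ t ∈ Icc a b, ‖w t‖ ≤ R) : IsSolution a b g ξ w :=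
  ⟨hw.1, fun t ht ↦ by rw [hfg t ht _ (hR t ht)]; exact hw.2 t ht⟩

/-- Since `g` is bounded and Lipschitz everywhere, the Picard–Lindelöf ball can have radius `M (b -
a)`, which covers all of `[a,b]` at once. -/
theorem exists_isSolution (hab : a < b) {g : ℝ → EuclideanSpace ℝ (Fin d) → EuclideanSpace ℝ (Fin d)}
    (hg : Continuous (Function.uncurry g)) {L M : ℝ} (hL0 : 0 ≤ L) (hM0 : 0 ≤ M)
    (hL : ∀ t x y, ‖g t x - g t y‖ ≤ L * ‖x - y‖) (hM : ∀ t x, ‖g t x‖ ≤ M) :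
    ∃ z, IsSolution a b g ξ z := by
  have hba : 0 ≤ b - a := by linarith
  have hPL : IsPicardLindelof g (tmin := a) (tmax := b) ⟨a, left_mem_Icc.2 hab.le⟩ ξ
      (M * (b - a)).toNNReal 0 M.toNNReal L.toNNReal :=
    { lipschitzOnWith := fun t _ ↦ (LipschitzWith.of_dist_le_mul fun x y ↦ by
        simpa [dist_eq_norm, Real.coe_toNNReal _ hL0] using hL t x y).lipschitzOnWith
      continuousOn := fun x _ ↦
        (hg.comp (by fun_prop : Continuous fun t : ℝ ↦ (t, x))).continuousOn
      norm_le := fun t _ x _ ↦ by simpa [Real.coe_toNNReal _ hM0] using hM t x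
      mul_max_le := by
        simp [Real.coe_toNNReal _ hM0, Real.coe_toNNReal _ (mul_nonneg hM0 hba), hba] }
  exact hPL.exists_eq_forall_mem_Icc_hasDerivWithinAt₀

theorem IsSolution.eqOn {g : ℝ → EuclideanSpace ℝ (Fin d) → EuclideanSpace ℝ (Fin d)}
    {L : ℝ} (hL0 : 0 ≤ L) (hL : ∀ t x y, ‖g t x - g t y‖ ≤ L * ‖x - y‖)
    {w z : ℝ → EuclideanSpace ℝ (Fin d)} (hw : IsSolution a b g ξ w) (hz : IsSolution a b g ξ z) :
    EqOn w z (Icc a b) :=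
  ODE_solution_unique_of_mem_Icc_right (v := g) (s := fun _ ↦ univ) (K := L.toNNReal)
    (fun t _ ↦ (LipschitzWith.of_dist_le_mul fun x y ↦ by
      simpa [dist_eq_norm, Real.coe_toNNReal _ hL0] using hL t x y).lipschitzOnWith)
    hw.continuousOn (fun _ ht ↦ hw.hasDerivWithinAt_Ici ht) (fun _ _ ↦ mem_univ _)
    hz.continuousOn (fun _ ht ↦ hz.hasDerivWithinAt_Ici ht) (fun _ _ ↦ mem_univ _)
    (hw.1.trans hz.1.symm)

/-- Each step multiplies `1 + ‖y‖` by at most `1 + K h ≤ exp (K h)`, giving the same radius as for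
exact solutions. -/
theorem norm_euler_le (hab : a < b) {K : ℝ} (hK : 0 ≤ K)
    (hA2 : ∀ t ∈ Icc a b, ∀ y, ‖f t y‖ ≤ K * (1 + ‖y‖)) {n : ℕ} {τ : ℕ → ℝ}
    (hτ : ∀ j, τ j ∈ Icc (0 : ℝ) 1) {k : ℕ} (hk : k ≤ n) (hn : 1 ≤ n) :
    ‖euler a b f ξ n τ k‖ ≤ (1 + ‖ξ‖) * Real.exp (K * (b - a)) := by
  have hh := step_pos hab hn
  have key : ∀ k ≤ n, 1 + ‖euler a b f ξ n τ k‖ ≤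
      (1 + ‖ξ‖) * Real.exp (K * (k * step a b n)) := by
    intro k
    induction k with
    | zero => simp [euler]
    | succ k ih =>
      intro hk
      set y := euler a b f ξ n τ k
      have h1 : ‖euler a b f ξ n τ (k + 1)‖ ≤ ‖y‖ + step a b n * (K * (1 + ‖y‖)) := by
        refine (norm_add_le _ _).trans ?_
        rw [norm_smul, Real.norm_eq_abs, abs_of_pos hh]
        gcongr
        exact hA2 _ (node_mem_Icc hab hk (hτ k)) _
      calc 1 + ‖euler a b f ξ n τ (k + 1)‖ ≤ (1 + ‖y‖) * (K * step a b n + 1) := by linarith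
        _ ≤ ((1 + ‖ξ‖) * Real.exp (K * (k * step a b n))) * Real.exp (K * step a b n) := by
          gcongr
          · exact ih (by omega)
          · exact Real.add_one_le_exp _
        _ = _ := by rw [mul_assoc, ← Real.exp_add]; push_cast; ring_nf
  have h1 := key k hk
  have h2 : Real.exp (K * (k * step a b n)) ≤ Real.exp (K * (b - a)) :=
    Real.exp_le_exp.2 (mul_le_mul_of_nonneg_left (natCast_mul_step_le hab hn hk) hK)
  have h3 := mul_le_mul_of_nonneg_left h2 (by positivity : 0 ≤ 1 + ‖ξ‖)
  linarith

theorem interp_congr_field (hab : a < b)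
    {g : ℝ → EuclideanSpace ℝ (Fin d) → EuclideanSpace ℝ (Fin d)} {R : ℝ}
    (hfg : ∀ t ∈ Icc a b, ∀ x, ‖x‖ ≤ R → g t x = f t x) {n : ℕ} (hn : 1 ≤ n) {τ : ℕ → ℝ}
    (hτ : ∀ j, τ j ∈ Icc (0 : ℝ) 1) (hR : ∀ k ≤ n, ‖euler a b f ξ n τ k‖ ≤ R) (t : ℝ) :
    interp a b g ξ n τ t = interp a b f ξ n τ t := by
  have he : ∀ k ≤ n, euler a b g ξ n τ k = euler a b f ξ n τ k := by
    intro k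
    induction k with
    | zero => intro _; rfl
    | succ k ih =>
      intro hk
      rw [euler, euler, ih (by omega), hfg _ (node_mem_Icc hab hk (hτ k)) _ (hR k (by omega))]
  have hk : min ⌊(t - a) / step a b n⌋₊ (n - 1) < n := by omega
  unfold interp piece
  rw [he _ hk.le, hfg _ (node_mem_Icc hab hk (hτ _)) _ (hR _ hk.le)]

end Truncation

/-! ### Measurability of the uniform error -/

section Measurability

variable {d : ℕ} {a b : ℝ} {g : ℝ → EuclideanSpace ℝ (Fin d) → EuclideanSpace ℝ (Fin d)}
  {ξ : EuclideanSpace ℝ (Fin d)}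

theorem continuous_field_node_euler (hg : Continuous (Function.uncurry g)) (n k : ℕ)
    (h : Continuous fun τ ↦ euler a b g ξ n τ k) :
    Continuous fun τ : ℕ → ℝ ↦ g (node a b n τ k) (euler a b g ξ n τ k) :=
  hg.comp (f := fun τ : ℕ → ℝ ↦ (node a b n τ k, euler a b g ξ n τ k))
    ((by unfold node; fun_prop : Continuous fun τ : ℕ → ℝ ↦ node a b n τ k).prodMk h)

theorem continuous_euler (hg : Continuous (Function.uncurry g)) (n k : ℕ) :
    Continuous fun τ ↦ euler a b g ξ n τ k := by
  induction k with
  | zero => exact continuous_const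
  | succ k ih => exact ih.add ((continuous_field_node_euler hg n k ih).const_smul (step a b n))

theorem continuous_interp (hg : Continuous (Function.uncurry g)) (n : ℕ) (t : ℝ) :
    Continuous fun τ ↦ interp a b g ξ n τ t :=
  (continuous_euler hg n _).add
    ((continuous_field_node_euler hg n _ (continuous_euler hg n _)).const_smul
      (t - grid a b n (min ⌊(t - a) / step a b n⌋₊ (n - 1))))

/-- The supremum is uncountable, but each term is continuous in `τ` for the product topology, so the
supremum is lower semicontinuous. -/
theorem measurable_iSup_error (hg : Continuous (Function.uncurry g))
    (z : ℝ → EuclideanSpace ℝ (Fin d)) (n : ℕ) :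
    Measurable fun τ : ℕ → ℝ ↦ ⨆ t ∈ Icc a b, ‖z t - interp a b g ξ n τ t‖ₑ :=
  LowerSemicontinuous.measurable <| lowerSemicontinuous_biSup fun t _ ↦
    (continuous_enorm.comp (continuous_const.sub (continuous_interp hg n t))).lowerSemicontinuous

end Measurability

/-! ### Uniformly distributed variables -/

section Uniform

variable {Ω : Type*} [MeasurableSpace Ω] {P : Measure Ω} {T : Ω → ℝ}

theorem map_eq_restrict_of_isUniform (hu : pdf.IsUniform T (Icc 0 1) P volume) :
    P.map T = volume.restrict (Icc (0 : ℝ) 1) := by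
  rw [hu, ProbabilityTheory.cond]
  simp

theorem ae_mem_Icc_of_isUniform (hT : Measurable T) (hu : pdf.IsUniform T (Icc 0 1) P volume) :
    ∀ᵐ ω ∂P, T ω ∈ Icc (0 : ℝ) 1 := by
  refine ae_of_ae_map hT.aemeasurable ?_
  rw [map_eq_restrict_of_isUniform hu]
  exact ae_restrict_mem measurableSet_Icc

theorem integral_comp_of_isUniform {E : Type*} [NormedAddCommGroup E] [NormedSpace ℝ E]
    (hT : Measurable T) (hu : pdf.IsUniform T (Icc 0 1) P volume) {φ : ℝ → E} (hφ : Continuous φ) :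
    ∫ ω, φ (T ω) ∂P = ∫ u in (0 : ℝ)..1, φ u := by
  rw [← integral_map (φ := T) (f := φ) hT.aemeasurable hφ.aestronglyMeasurable,
    map_eq_restrict_of_isUniform hu, integral_Icc_eq_integral_Ioc,
    intervalIntegral.integral_of_le zero_le_one]

end Uniform

/-! ### The rate for the truncated field -/

theorem rpow_le_mul_rpow {h B s m : ℝ} (hh : 0 < h) (hB : h ≤ B) (hms : m ≤ s) :
    h ^ s ≤ B ^ (s - m) * h ^ m := by
  calc h ^ s = h ^ (s - m) * h ^ m := by rw [← Real.rpow_add hh, sub_add_cancel]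
    _ ≤ _ := by
      have : 0 ≤ s - m := sub_nonneg.2 hms
      gcongr

/-- Since `n h = b - a`, one has `√n h = √(b - a) √h`: random cancellation costs half a power of `h`
instead of a full one. -/
theorem sqrt_natCast_mul_step {a b : ℝ} (hab : a < b) {n : ℕ} (hn : 1 ≤ n) (ϱ : ℝ) :
    √n * (step a b n ^ ϱ * step a b n) = √(b - a) * step a b n ^ (ϱ + 1 / 2) := by
  have hh := step_pos hab hn
  rw [← natCast_mul_step (a := a) (b := b) hn, Real.sqrt_mul (Nat.cast_nonneg n), Real.rpow_add hh,
    ← Real.sqrt_eq_rpow]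
  nth_rewrite 2 [← Real.mul_self_sqrt hh.le]
  ring

/-- Error bound for the randomized Euler scheme driven by a bounded, globally Lipschitz field. -/
theorem exists_eLpNorm_iSup_error_le {d : ℕ} {a b : ℝ} (hab : a < b)
    {g : ℝ → EuclideanSpace ℝ (Fin d) → EuclideanSpace ℝ (Fin d)}
    {ξ : EuclideanSpace ℝ (Fin d)} {z : ℝ → EuclideanSpace ℝ (Fin d)}
    {ϱ p L M H : ℝ} (hϱ : 0 ≤ ϱ) (hp : 1 ≤ p) (hg : Continuous (Function.uncurry g))
    (hL0 : 0 ≤ L) (hM0 : 0 ≤ M) (hH0 : 0 < H)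
    (hL : ∀ t x y, ‖g t x - g t y‖ ≤ L * ‖x - y‖) (hM : ∀ t x, ‖g t x‖ ≤ M)
    (hH : ∀ t s x, ‖g t x - g s x‖ ≤ H * |t - s| ^ ϱ) (hz : IsSolution a b g ξ z)
    {Ω : Type*} [MeasurableSpace Ω] (P : Measure Ω) [IsProbabilityMeasure P]
    {τ : ℕ → Ω → ℝ} (hτm : ∀ j, Measurable (τ j))
    (hτu : ∀ j, pdf.IsUniform (τ j) (Icc 0 1) P volume) (hτi : iIndepFun τ P) :
    ∃ C : ℝ, 0 ≤ C ∧ ∀ n : ℕ, 1 ≤ n →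
      eLpNorm (fun ω ↦ ⨆ t ∈ Icc a b, ‖z t - interp a b g ξ n (fun j ↦ τ j ω) t‖ₑ)
        (ENNReal.ofReal p) P ≤ ENNReal.ofReal (C * step a b n ^ min (ϱ + 1 / 2) 1) := by
  have hba : 0 < b - a := sub_pos.2 hab
  have hmc := momentConst_nonneg (by linarith : 0 < p)
  have hp1 : 1 ≤ ENNReal.ofReal p := by simpa using hp
  set E := Real.exp (L * (b - a))
  have hE : 0 < E := Real.exp_pos _
  set m := min (ϱ + 1 / 2) 1
  set A := E * (d * (2 * (H * √(b - a) * momentConst p))) with hA_def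
  have hA : 0 ≤ A := by positivity
  set B := E * ((b - a) * L * M) + 2 * M
  have hB : 0 ≤ B := by positivity
  -- The powers of `b - a` lower both exponents to `m`; they are needed because `h ≤ b - a` may
  -- exceed 1.
  refine ⟨A * (b - a) ^ (ϱ + 1 / 2 - m) + B * (b - a) ^ (1 - m), by positivity, fun n hn ↦ ?_⟩
  have hh := step_pos hab hn
  have hhb : step a b n ≤ b - a := by simpa using natCast_mul_step_le (k := 1) hab hn hn
  obtain ⟨D, hDm, hD, hDn⟩ := exists_dominating_norm_partial_sums (P := P)
    (X := fun j ω ↦ quadError a b g z n j (τ j ω)) (c := H * step a b n ^ ϱ * step a b n)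
    (fun j ↦ (continuous_quadError hg n j).measurable.comp (hτm j))
    (hτi.comp (fun j ↦ quadError a b g z n j) fun j ↦ (continuous_quadError hg n j).measurable)
    (fun j ↦ by
      rw [integral_comp_of_isUniform (hτm j) (hτu j) (continuous_quadError hg n j),
        integral_quadError hg])
    (by positivity)
    (fun j ↦ (ae_mem_Icc_of_isUniform (hτm j) (hτu j)).mono fun ω hω ↦
      norm_quadError_le hab hg hϱ hH0.le hH hn j hω) hn hp
  have hD0 : ∀ ω, 0 ≤ D ω := fun ω ↦ (norm_nonneg _).trans (hD ω 0 (Nat.zero_le _))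
  have hpt : ∀ ω, ‖⨆ t ∈ Icc a b, ‖z t - interp a b g ξ n (fun j ↦ τ j ω) t‖ₑ‖ₑ ≤
      ‖(E • D + fun _ : Ω ↦ B * step a b n : Ω → ℝ) ω‖ₑ := by
    intro ω
    have h0 : 0 ≤ E * D ω + B * step a b n :=
      add_nonneg (mul_nonneg hE.le (hD0 ω)) (by positivity)
    rw [enorm_eq_self, Pi.add_apply, Pi.smul_apply, smul_eq_mul, Real.enorm_of_nonneg h0]
    refine iSup₂_le fun t ht ↦ ?_
    rw [← ofReal_norm]
    exact ENNReal.ofReal_le_ofReal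
      (norm_solution_sub_interp_le hab hg hL0 hM0 hL hM hz hn _ (hD ω) ht)
  have hconst : E * (d * (2 * (√n * (H * step a b n ^ ϱ * step a b n) * momentConst p))) =
      A * step a b n ^ (ϱ + 1 / 2) := by
    have := sqrt_natCast_mul_step hab hn ϱ
    calc _ = E * (d * (2 * (H * (√n * (step a b n ^ ϱ * step a b n)) * momentConst p))) := by ring
      _ = _ := by rw [this, hA_def]; ring
  calc _ ≤ eLpNorm (E • D + fun _ : Ω ↦ B * step a b n) (ENNReal.ofReal p) P :=
        eLpNorm_mono_enorm hpt
    _ ≤ eLpNorm (E • D) (ENNReal.ofReal p) P +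
        eLpNorm (fun _ : Ω ↦ B * step a b n) (ENNReal.ofReal p) P :=
        eLpNorm_add_le (hDm.const_smul E).aestronglyMeasurable aestronglyMeasurable_const hp1
    _ ≤ ENNReal.ofReal (A * step a b n ^ (ϱ + 1 / 2)) + ENNReal.ofReal (B * step a b n) := by
        refine add_le_add ?_ (le_of_eq ?_)
        · rw [eLpNorm_const_smul, Real.enorm_of_nonneg hE.le, ← hconst, ENNReal.ofReal_mul hE.le]
          gcongr
        · rw [eLpNorm_const _ (by positivity) (IsProbabilityMeasure.ne_zero P), measure_univ,
            ENNReal.one_rpow, mul_one, Real.enorm_of_nonneg (by positivity)]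
    _ = ENNReal.ofReal (A * step a b n ^ (ϱ + 1 / 2) + B * step a b n) :=
        (ENNReal.ofReal_add (by positivity) (by positivity)).symm
    _ ≤ _ := by
        refine ENNReal.ofReal_le_ofReal ?_
        have h1 := rpow_le_mul_rpow hh hhb (min_le_left (ϱ + 1 / 2) 1 : m ≤ _)
        have h2 := rpow_le_mul_rpow hh hhb (min_le_right (ϱ + 1 / 2) 1 : m ≤ _)
        rw [Real.rpow_one] at h2
        linarith [mul_le_mul_of_nonneg_left h1 hA, mul_le_mul_of_nonneg_left h2 hB]

end RandEuler

/-! ### Transfer to the original field -/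

theorem mainTheorem6 {d : ℕ} {a b : ℝ} (hab : a < b)
    (f : ℝ → EuclideanSpace ℝ (Fin d) → EuclideanSpace ℝ (Fin d))
    (ξ : EuclideanSpace ℝ (Fin d)) (ϱ : ℝ) (hϱ : ϱ ∈ Ioc (0 : ℝ) 1)
    (p : ℝ) (hp : 2 ≤ p)
    -- `f` is continuous on `[a,b] × ℝ^d`
    (hA1 : ContinuousOn (Function.uncurry f) (Icc a b ×ˢ univ))
    -- linear growth
    (hA2 : ∃ K : ℝ, 0 ≤ K ∧ ∀ t ∈ Icc a b, ∀ y, ‖f t y‖ ≤ K * (1 + ‖y‖))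
    -- local Lipschitz condition in the space variable
    (hA3 : ∀ R : ℝ, 0 < R → ∃ L : ℝ, 0 ≤ L ∧ ∀ t ∈ Icc a b, ∀ x y,
      ‖x‖ ≤ R → ‖y‖ ≤ R → ‖f t x - f t y‖ ≤ L * ‖x - y‖)
    -- Hölder condition in time, locally uniformly in the space variable
    (hA4 : ∀ H : ℝ, 0 < H → ∃ L : ℝ, 0 ≤ L ∧ ∀ t ∈ Icc a b, ∀ s ∈ Icc a b, ∀ x,
      ‖x‖ ≤ H → ‖f t x - f s x‖ ≤ L * |t - s| ^ ϱ)
    {Ω : Type*} [MeasurableSpace Ω] (P : Measure Ω) [IsProbabilityMeasure P]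
    -- an i.i.d. sequence, uniformly distributed on `[0,1]`
    (τ : ℕ → Ω → ℝ) (hτm : ∀ j, Measurable (τ j))
    (hτu : ∀ j, pdf.IsUniform (τ j) (Icc 0 1) P volume)
    (hτi : iIndepFun τ P) :
    ∃ z : ℝ → EuclideanSpace ℝ (Fin d),
      -- `z` is the unique solution on `[a,b]`
      (RandEuler.IsSolution a b f ξ z ∧
        ∀ w, RandEuler.IsSolution a b f ξ w → EqOn w z (Icc a b)) ∧
      ∃ C : ℝ, 0 ≤ C ∧ ∀ n : ℕ, 1 ≤ n →
        AEMeasurable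
          (fun ω ↦ ⨆ t ∈ Icc a b, ‖z t - RandEuler.interp a b f ξ n (fun j ↦ τ j ω) t‖ₑ) P ∧
        eLpNorm
          (fun ω ↦ ⨆ t ∈ Icc a b, ‖z t - RandEuler.interp a b f ξ n (fun j ↦ τ j ω) t‖ₑ)
          (ENNReal.ofReal p) P ≤
          ENNReal.ofReal (C * RandEuler.step a b n ^ min (ϱ + 1 / 2) 1) := by
  obtain ⟨K, hK, hA2⟩ := hA2
  have hR : 0 ≤ (1 + ‖ξ‖) * Real.exp (K * (b - a)) := by positivity
  obtain ⟨g, L, M, H, hg, hL0, hM0, hH0, hL, hM, hH, hgrowth, hfg⟩ :=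
    RandEuler.exists_truncation hab hϱ.1.le hA1 hK hA2 hA3 hA4 hR
  obtain ⟨z, hz⟩ := RandEuler.exists_isSolution (ξ := ξ) hab hg hL0 hM0 hL hM
  have hzf : RandEuler.IsSolution a b f ξ z :=
    hz.congr_field (fun t ht x hx ↦ (hfg t ht x hx).symm)
      fun t ht ↦ hz.norm_le hK (fun t _ x ↦ hgrowth t x) ht
  refine ⟨z, ⟨hzf, fun w hw ↦ ?_⟩, ?_⟩
  · exact (hw.congr_field hfg fun t ht ↦ hw.norm_le hK hA2 ht).eqOn hL0 hL hz
  · obtain ⟨C, hC, hbound⟩ := RandEuler.exists_eLpNorm_iSup_error_le hab hϱ.1.le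
      (by linarith : 1 ≤ p) hg hL0 hM0 hH0 hL hM hH hz P hτm hτu hτi
    refine ⟨C, hC, fun n hn ↦ ?_⟩
    -- The schemes for `f` and `g` agree when all `τ j` lie in `[0,1]`, which holds only almost
    -- surely; off that event `f` may be evaluated outside `[a,b]`, hence a.e. measurability.
    have hcongr : (fun ω ↦ ⨆ t ∈ Icc a b,
          ‖z t - RandEuler.interp a b g ξ n (fun j ↦ τ j ω) t‖ₑ) =ᵐ[P]
        fun ω ↦ ⨆ t ∈ Icc a b, ‖z t - RandEuler.interp a b f ξ n (fun j ↦ τ j ω) t‖ₑ := by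
      filter_upwards [ae_all_iff.2 fun j ↦
        RandEuler.ae_mem_Icc_of_isUniform (hτm j) (hτu j)] with ω hω
      simp only [RandEuler.interp_congr_field hab hfg hn hω
        fun k hk ↦ RandEuler.norm_euler_le hab hK hA2 hω hk hn]
    refine ⟨AEMeasurable.congr ?_ hcongr, ?_⟩
    · exact ((RandEuler.measurable_iSup_error hg z n).comp
        (measurable_pi_lambda _ hτm)).aemeasurable
    · rw [← eLpNorm_congr_ae hcongr]
      exact hbound n hn
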